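/- Let $A$ be a finite alphabet and let $\overline{\Omega}_A\mathsf{M}$ be the free profinite monoid on $A$, i.e. the inverse limit of all finite quotients of the free monoid $A^*$ (each discrete); its elements are called pseudowords. A pseudovariety of ordered monoids is a class $\mathsf V$ of finite monoids with a compatible partial order that is closed under images by order-preserving homomorphisms, submonoids and finite direct products (including the empty one). A language $L\subseteq A^*$ is $\mathsf V$-recognizable if $L=\varphi^{-1}(F)$ for some homomorphism $\varphi\colon A^*\to M$ with $M\in\mathsf V$ and some up-closed subset $F\subseteq M$. The pseudovariety $\mathsf V$ is polynomially closed if, for every finite alphabet, the $\mathsf V$-recognizable languages are exactly the finite unions of languages $L_0a_1L_1\cdots a_nL_n$ with $n\ge 0$, each $a_i$ a letter and each $L_i$ a $\mathsf V$-recognizable language. For pseudowords $u,v\in\overline{\Omega}_A\mathsf{M}$, the inequality $u\le v$ holds in $\mathsf V$ if $\varphi(u)\le\varphi(v)$ for every continuous homomorphism $\varphi\colon\overline{\Omega}_A\mathsf{M}\to M$ into a (discrete) member $M$ of $\mathsf V$. **Theorem.** Let $\mathsf V$ be a polynomially closed pseudovariety of ordered monoids, let $A$ be a finite alphabet and let $u,v\in\overline{\Omega}_A\mathsf{M}$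 be such that $u\le v$ holds in $\mathsf V$. 1. For every factorization $u=u_0au_1$ with $a\in A$ and $u_0,u_1\in\overline{\Omega}_A\mathsf{M}$, there is a factorization $v=v_0av_1$ with $v_0,v_1\in\overline{\Omega}_A\mathsf{M}$ such that $u_0\le v_0$ and $u_1\le v_1$ hold in $\mathsf V$. 2. For every $n\ge 1$ and every factorization $u=u_1\cdots u_n$ with $u_i\in\overline{\Omega}_A\mathsf{M}$, there is a factorization $v=v_1\cdots v_n$ with $v_i\in\overline{\Omega}_A\mathsf{M}$ such that $u_i\le v_i$ holds in $\mathsf V$ for each $i=1,\dots,n$. -/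

import Mathlib

open scoped Pointwise

universe u w

/-! ### The free profinite monoid (pseudowords) -/

/-- The congruences of finite index on the free monoid `A*`. -/
def FiniteIndexCon (A : Type w) : Type w :=
  {c : Con (FreeMonoid A) // Finite c.Quotient}

/-- The compatible families in the product of all finite quotients of `A*`, that is, the inverse
limit of the projective system of finite `A`-generated monoids, as a submonoid of the product. -/
def pseudowordSubmonoid (A : Type w) :
    Submonoid ((c : FiniteIndexCon A) → c.1.Quotient) where
  carrier := {x | ∀ (c d : FiniteIndexCon A) (h : c.1 ≤ d.1), Con.map c.1 d.1 h (x c) = x d}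
  one_mem' := fun c d h => map_one (Con.map c.1 d.1 h)
  mul_mem' := by
    intro x y hx hy c d h
    rw [Pi.mul_apply, Pi.mul_apply, map_mul, hx c d h, hy c d h]

/-- The free profinite monoid on `A`; its elements are the pseudowords over `A`. -/
def Pseudoword (A : Type w) : Type w := pseudowordSubmonoid A

namespace Pseudoword

instance (A : Type w) : Monoid (Pseudoword A) :=
  inferInstanceAs (Monoid (pseudowordSubmonoid A))

/-- The profinite topology: the subspace topology of the product of discrete finite quotients. -/
instance (A : Type w) : TopologicalSpace (Pseudoword A) :=
  TopologicalSpace.induced (fun x : Pseudoword A => x.1)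
    (@Pi.topologicalSpace (FiniteIndexCon A) (fun c => c.1.Quotient) (fun _ => ⊥))

/-- The canonical homomorphism from words to pseudowords. -/
def ofWord {A : Type w} : FreeMonoid A →* Pseudoword A where
  toFun x := ⟨fun c => (x : c.1.Quotient), fun _ _ _ => rfl⟩
  map_one' := rfl
  map_mul' _ _ := rfl

/-- A letter, seen as a pseudoword. -/
def letter {A : Type w} (a : A) : Pseudoword A := ofWord (FreeMonoid.of a)

end Pseudoword

/-! ### Pseudovarieties of ordered monoids -/

/-- A pseudovariety of ordered monoids: a class of finite monoids with a compatible partial order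
that is closed under images by order-preserving monoid homomorphisms, under submonoids (with the
induced order) and under finite direct products (with the componentwise order; the empty product
is included). -/
structure OrderedMonoidPseudovariety where
  /-- The members of the class. -/
  Mem : (M : Type u) → [Monoid M] → [PartialOrder M] → Prop
  finite : ∀ (M : Type u) [Monoid M] [PartialOrder M], Mem M → Finite M
  mulLeftMono : ∀ (M : Type u) [Monoid M] [PartialOrder M], Mem M → MulLeftMono M
  mulRightMono : ∀ (M : Type u) [Monoid M] [PartialOrder M], Mem M → MulRightMono M
  image : ∀ (M N : Type u) [Monoid M] [PartialOrder M] [Monoid N] [PartialOrder N]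
    [MulLeftMono N] [MulRightMono N] (f : M →* N),
    Monotone f → Function.Surjective f → Mem M → Mem N
  submonoid : ∀ (M : Type u) [Monoid M] [PartialOrder M] (S : Submonoid M), Mem M → Mem S
  pi : ∀ (ι : Type) [Finite ι] (M : ι → Type u) [∀ i, Monoid (M i)] [∀ i, PartialOrder (M i)],
    (∀ i, Mem (M i)) → Mem ((i : ι) → M i)

/-! ### Polynomial closure -/

/-- The language `L₀ a₁ L₁ ⋯ aₙ Lₙ`, the pairs `(aᵢ, Lᵢ)`, `1 ≤ i ≤ n`, being given as a list. -/
def markedProduct {A : Type w} (L₀ : Set (FreeMonoid A)) :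
    List (A × Set (FreeMonoid A)) → Set (FreeMonoid A)
  | [] => L₀
  | p :: l => L₀ * {FreeMonoid.of p.1} * markedProduct p.2 l

/-- The polynomial closure of a set of languages over `A`: all finite unions of languages
`L₀ a₁ L₁ ⋯ aₙ Lₙ` with `n ≥ 0`, the `aᵢ` letters and the `Lᵢ` in the given set. -/
def polynomialClosure {A : Type w} (𝓛 : Set (Set (FreeMonoid A))) : Set (Set (FreeMonoid A)) :=
  {L | ∃ S : Set (Set (FreeMonoid A)), S.Finite ∧ L = ⋃₀ S ∧
    ∀ K ∈ S, ∃ L₀ ∈ 𝓛, ∃ l : List (A × Set (FreeMonoid A)),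
      (∀ p ∈ l, p.2 ∈ 𝓛) ∧ K = markedProduct L₀ l}

namespace OrderedMonoidPseudovariety

/-- The `V`-recognizable languages over `A`: inverse images of up-closed subsets under
homomorphisms from `A*` into members of `V`. -/
def recognizable (V : OrderedMonoidPseudovariety.{u}) (A : Type w) : Set (Set (FreeMonoid A)) :=
  {L | ∃ (M : Type u) (_ : Monoid M) (_ : PartialOrder M), V.Mem M ∧
    ∃ (φ : FreeMonoid A →* M) (F : Set M), IsUpperSet F ∧ L = φ ⁻¹' F}

/-- `V` is polynomially closed if, over each finite alphabet, the `V`-recognizable languages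
coincide with their polynomial closure. -/
def PolynomiallyClosed (V : OrderedMonoidPseudovariety.{u}) : Prop :=
  ∀ (A : Type w) [Finite A], V.recognizable A = polynomialClosure (V.recognizable A)

/-- The inequality `x ≤ y` of pseudowords holds in `V`: every continuous homomorphism `φ` into
a (discrete) member of `V` satisfies `φ x ≤ φ y`. -/
def Satisfies (V : OrderedMonoidPseudovariety.{u}) {A : Type w} (x y : Pseudoword A) : Prop :=
  ∀ (M : Type u) [Monoid M] [PartialOrder M] [TopologicalSpace M] [DiscreteTopology M],
    V.Mem M → ∀ φ : Pseudoword A →* M, Continuous φ → φ x ≤ φ y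

end OrderedMonoidPseudovariety

/-! Fix one continuous `Φ` into a member of `V`. The words lying above `x₀`, resp. `x₁`, under `Φ`
form `V`-recognizable languages `L₀`, `L₁`, so polynomial closure makes `L₀ a L₁` recognizable, by
an up-closed set in some member of `V`. Hence `x₀ a x₁ ≤ y` makes `y` a limit of words of `L₀ a L₁`,
and compactness splits `y` accordingly (`factorizations_nonempty`). The splittings valid for `Φ`
form a closed set, and products make these sets directed, so compactness gives one splitting valid
for all `Φ` (`exists_factorization_letter`). For unmarked products, a nontrivial pseudoword has a
last letter (`eq_one_or_eq_mul_letter`), which serves as the marker; induction handles `n` factors.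
-/

namespace Pseudoword

variable {A : Type w}

/-- The discrete topology on the quotients of the free monoid by congruences of finite index. -/
local instance discreteQuotient (c : FiniteIndexCon A) : TopologicalSpace c.1.Quotient := ⊥

local instance (c : FiniteIndexCon A) : DiscreteTopology c.1.Quotient := ⟨rfl⟩

local instance (c : FiniteIndexCon A) : Finite c.1.Quotient := c.2

theorem isEmbedding_val :
    Topology.IsEmbedding (fun x : Pseudoword A => (x.1 : (c : FiniteIndexCon A) → c.1.Quotient)) :=
  ⟨⟨rfl⟩, Subtype.val_injective⟩

/-- The component of a pseudoword in a finite quotient of the free monoid. -/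
def component (c : FiniteIndexCon A) : Pseudoword A →* c.1.Quotient where
  toFun x := x.1 c
  map_one' := rfl
  map_mul' _ _ := rfl

theorem continuous_component (c : FiniteIndexCon A) : Continuous (component c) :=
  (continuous_apply c).comp isEmbedding_val.continuous

theorem isClosed_pseudowordSubmonoid :
    IsClosed (pseudowordSubmonoid A : Set ((c : FiniteIndexCon A) → c.1.Quotient)) := by
  have : (pseudowordSubmonoid A : Set ((c : FiniteIndexCon A) → c.1.Quotient)) =
      ⋂ (c : FiniteIndexCon A) (d : FiniteIndexCon A) (h : c.1 ≤ d.1),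
        {x | Con.map c.1 d.1 h (x c) = x d} := by
    ext x
    simp only [Set.mem_iInter]
    rfl
  rw [this]
  exact isClosed_iInter fun c => isClosed_iInter fun d => isClosed_iInter fun h =>
    isClosed_eq (continuous_of_discreteTopology.comp (continuous_apply c)) (continuous_apply d)

instance : CompactSpace (Pseudoword A) := by
  have h : Topology.IsClosedEmbedding
      (fun x : Pseudoword A => (x.1 : (c : FiniteIndexCon A) → c.1.Quotient)) := by
    refine ⟨isEmbedding_val, ?_⟩
    have : Set.range (fun x : Pseudoword A => (x.1 : (c : FiniteIndexCon A) → c.1.Quotient)) =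
        pseudowordSubmonoid A := Subtype.range_val
    rw [this]
    exact isClosed_pseudowordSubmonoid
  exact h.compactSpace

instance : T2Space (Pseudoword A) := isEmbedding_val.t2Space

instance : ContinuousMul (Pseudoword A) where
  continuous_mul := by
    refine isEmbedding_val.continuous_iff.2 (continuous_pi fun c => ?_)
    exact ((continuous_component c).comp continuous_fst).mul
      ((continuous_component c).comp continuous_snd)

theorem exists_le_of_finset (s : Finset (FiniteIndexCon A)) :
    ∃ d : FiniteIndexCon A, ∀ c ∈ s, d.1 ≤ c.1 := by
  let f : FreeMonoid A →* ((c : s) → c.1.1.Quotient) := MonoidHom.pi fun c => c.1.1.mk'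
  have : Finite (Con.ker f).Quotient := Finite.of_injective _ (Con.kerLift_injective f)
  refine ⟨⟨Con.ker f, this⟩, fun c hc x y hxy => ?_⟩
  exact (Con.eq c.1).1 (congrFun ((Con.ker_rel f).1 hxy) ⟨c, hc⟩)

theorem denseRange_ofWord : DenseRange (ofWord : FreeMonoid A → Pseudoword A) := by
  intro x
  refine mem_closure_iff.2 fun o ho hx => ?_
  obtain ⟨t, ht, rfl⟩ := isEmbedding_val.isOpen_iff.1 ho
  obtain ⟨I, v, hv, hsub⟩ := isOpen_pi_iff.1 ht _ hx
  -- A basic open set constrains finitely many components, all determined by the one at a common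
  -- refinement `d`.
  obtain ⟨d, hd⟩ := exists_le_of_finset I
  obtain ⟨w, hw⟩ := Con.mk'_surjective (c := d.1) (x.1 d)
  refine ⟨ofWord w, hsub fun c hc => ?_, w, rfl⟩
  have h : (ofWord w).1 c = x.1 c := by
    rw [← x.2 d c (hd c hc), ← hw]
    rfl
  change (ofWord w).1 c ∈ v c
  exact Set.mem_of_eq_of_mem h (hv c hc).2

theorem continuous_comp_component {N : Type*} [Monoid N] [TopologicalSpace N]
    (c : FiniteIndexCon A) (f : c.1.Quotient →* N) : Continuous (f.comp (component c)) :=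
  (continuous_of_discreteTopology (f := f)).comp (continuous_component c)

theorem exists_continuous_extension {N : Type*} [Monoid N] [Finite N] [TopologicalSpace N]
    (ψ : FreeMonoid A →* N) :
    ∃ Ψ : Pseudoword A →* N, Continuous Ψ ∧ ∀ w, Ψ (ofWord w) = ψ w :=
  ⟨_, continuous_comp_component
    ⟨Con.ker ψ, Finite.of_injective _ (Con.kerLift_injective ψ)⟩ (Con.kerLift ψ), fun _ => rfl⟩

/-- True of words, which are dense; the condition is closed because `A` is finite and each set of
multiples of a letter is compact. -/
theorem eq_one_or_eq_mul_letter [Finite A] (x : Pseudoword A) :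
    x = 1 ∨ ∃ (a : A) (z : Pseudoword A), x = z * letter a := by
  let C : Set (Pseudoword A) := {1} ∪ ⋃ a : A, Set.range fun z : Pseudoword A => z * letter a
  have hC : IsClosed C := isClosed_singleton.union <| isClosed_iUnion_of_finite fun a =>
    (isCompact_range (continuous_mul_const (letter a))).isClosed
  have hsub : Set.range (ofWord : FreeMonoid A → Pseudoword A) ⊆ C := by
    rintro _ ⟨w, rfl⟩
    rcases List.eq_nil_or_concat (FreeMonoid.toList w) with h | ⟨l, a, h⟩
    · left
      have : w = 1 := h
      simp [this]
    · right
      have : w = FreeMonoid.ofList l * FreeMonoid.of a := h.trans List.concat_eq_append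
      exact Set.mem_iUnion.2 ⟨a, ofWord (FreeMonoid.ofList l), by rw [this, map_mul]; rfl⟩
  rcases closure_minimal hsub hC (denseRange_ofWord x) with h | h
  · exact Or.inl h
  · obtain ⟨a, z, h⟩ := Set.mem_iUnion.1 h
    exact Or.inr ⟨a, z, h.symm⟩

end Pseudoword

namespace OrderedMonoidPseudovariety

open Pseudoword

variable {V : OrderedMonoidPseudovariety.{u}} {A : Type w}

theorem Satisfies.refl (x : Pseudoword A) : V.Satisfies x x :=
  fun _ _ _ _ _ _ _ _ => le_rfl

theorem Satisfies.mul {x y x' y' : Pseudoword A} (h : V.Satisfies x y) (h' : V.Satisfies x' y') :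
    V.Satisfies (x * x') (y * y') := by
  intro M _ _ _ _ hM φ hφ
  have := V.mulLeftMono M hM
  have := V.mulRightMono M hM
  rw [map_mul, map_mul]
  exact mul_le_mul' (h M hM φ hφ) (h' M hM φ hφ)

/-- A continuous homomorphism from pseudowords to a discrete member of `V`. -/
structure ContinuousMemHom (V : OrderedMonoidPseudovariety.{u}) (A : Type w) where
  /-- The target. -/
  carrier : Type u
  [monoid : Monoid carrier]
  [order : PartialOrder carrier]
  [topology : TopologicalSpace carrier]
  [discrete : DiscreteTopology carrier]
  mem : V.Mem carrier
  /-- The homomorphism. -/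
  hom : Pseudoword A →* carrier
  continuous : Continuous hom

attribute [instance] ContinuousMemHom.monoid ContinuousMemHom.order ContinuousMemHom.topology
  ContinuousMemHom.discrete

/-- Bundling turns the test homomorphisms into an index type for the compactness argument. -/
theorem satisfies_iff {x y : Pseudoword A} :
    V.Satisfies x y ↔ ∀ Φ : ContinuousMemHom V A, Φ.hom x ≤ Φ.hom y :=
  ⟨fun h Φ => h Φ.carrier Φ.mem Φ.hom Φ.continuous,
    fun h M _ _ _ _ hM φ hφ => h ⟨M, hM, φ, hφ⟩⟩

/-- The homomorphism to the product of a finite family of members of `V`. -/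
def ContinuousMemHom.pi {ι : Type} [Finite ι] (Φ : ι → ContinuousMemHom V A) :
    ContinuousMemHom V A where
  carrier := (i : ι) → (Φ i).carrier
  mem := V.pi ι _ fun i => (Φ i).mem
  hom := MonoidHom.pi fun i => (Φ i).hom
  continuous := continuous_pi fun i => (Φ i).continuous

theorem ContinuousMemHom.isClosed_setOf_le (Φ : ContinuousMemHom V A) (x : Pseudoword A) :
    IsClosed {y | Φ.hom x ≤ Φ.hom y} :=
  (isClosed_discrete (Set.Ici (Φ.hom x))).preimage Φ.continuous

theorem mul_letter_mul_mem_recognizable [Finite A]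
    (hV : OrderedMonoidPseudovariety.PolynomiallyClosed.{u, w} V)
    {L₀ L₁ : Set (FreeMonoid A)} (h₀ : L₀ ∈ V.recognizable A) (h₁ : L₁ ∈ V.recognizable A) (a : A) :
    L₀ * {FreeMonoid.of a} * L₁ ∈ V.recognizable A := by
  rw [hV A]
  refine ⟨{L₀ * {FreeMonoid.of a} * L₁}, Set.finite_singleton _, (Set.sUnion_singleton _).symm, ?_⟩
  rintro K rfl
  exact ⟨L₀, h₀, [(a, L₁)], by simpa using h₁, rfl⟩

theorem ContinuousMemHom.preimage_Ici_mem_recognizable (Φ : ContinuousMemHom V A)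
    (x : Pseudoword A) : {w | Φ.hom x ≤ Φ.hom (ofWord w)} ∈ V.recognizable A :=
  ⟨Φ.carrier, _, _, Φ.mem, Φ.hom.comp ofWord, Set.Ici (Φ.hom x), isUpperSet_Ici _, rfl⟩

/-- The factorizations `y = y₀ a y₁` such that `x₀ ≤ y₀` and `x₁ ≤ y₁` hold under `Φ`. -/
def factorizations (Φ : ContinuousMemHom V A) (a : A) (x₀ x₁ y : Pseudoword A) :
    Set (Pseudoword A × Pseudoword A) :=
  {p | y = p.1 * letter a * p.2} ∩
    ({z | Φ.hom x₀ ≤ Φ.hom z} ×ˢ {z | Φ.hom x₁ ≤ Φ.hom z})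

theorem isClosed_factorizations (Φ : ContinuousMemHom V A) (a : A) (x₀ x₁ y : Pseudoword A) :
    IsClosed (factorizations Φ a x₀ x₁ y) :=
  (isClosed_eq continuous_const (by fun_prop)).inter
    ((Φ.isClosed_setOf_le x₀).prod (Φ.isClosed_setOf_le x₁))

theorem factorizations_nonempty [Finite A]
    (hV : OrderedMonoidPseudovariety.PolynomiallyClosed.{u, w} V)
    (Φ : ContinuousMemHom V A) (a : A) {x₀ x₁ y : Pseudoword A}
    (h : V.Satisfies (x₀ * letter a * x₁) y) : (factorizations Φ a x₀ x₁ y).Nonempty := by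
  obtain ⟨N, _, _, hN, ψ, F, hF, hL⟩ := mul_letter_mul_mem_recognizable hV
    (Φ.preimage_Ici_mem_recognizable x₀) (Φ.preimage_Ici_mem_recognizable x₁) a
  let _ : TopologicalSpace N := ⊥
  have : DiscreteTopology N := ⟨rfl⟩
  have := V.finite N hN
  obtain ⟨Ψ, hΨ, hΨψ⟩ := exists_continuous_extension ψ
  -- `hL` speaks of words only, so each factor is replaced by a word with the same image under both
  -- `Φ` and `Ψ`.
  have approx (z : Pseudoword A) :
      ∃ w : FreeMonoid A, Φ.hom (ofWord w) = Φ.hom z ∧ Ψ (ofWord w) = Ψ z := by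
    obtain ⟨w, hw⟩ := denseRange_ofWord.exists_mem_open
      (((isOpen_discrete {Φ.hom z}).preimage Φ.continuous).inter
        ((isOpen_discrete {Ψ z}).preimage hΨ)) ⟨z, rfl, rfl⟩
    exact ⟨w, hw.1, hw.2⟩
  have hx : Ψ (x₀ * letter a * x₁) ∈ F := by
    obtain ⟨w₀, hw₀, hw₀'⟩ := approx x₀
    obtain ⟨w₁, hw₁, hw₁'⟩ := approx x₁
    have hmem : w₀ * FreeMonoid.of a * w₁ ∈ ψ ⁻¹' F := by
      rw [← hL]
      exact Set.mul_mem_mul (Set.mul_mem_mul hw₀.ge rfl) hw₁.ge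
    rw [map_mul, map_mul, ← hw₀', ← hw₁', letter, ← map_mul, ← map_mul, ← map_mul, ← map_mul, hΨψ]
    exact hmem
  have hy : y ∈ Ψ ⁻¹' F := hF (h N hN Ψ hΨ) hx
  have hC : IsClosed ((fun p : Pseudoword A × Pseudoword A => p.1 * letter a * p.2) ''
      ({z | Φ.hom x₀ ≤ Φ.hom z} ×ˢ {z | Φ.hom x₁ ≤ Φ.hom z})) :=
    ((((Φ.isClosed_setOf_le x₀).prod (Φ.isClosed_setOf_le x₁)).isCompact).image
      (by fun_prop)).isClosed
  -- Words are dense in the open set `Ψ ⁻¹' F`, and those in it belong to `L₀ a L₁`, hence to the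
  -- compact image `hC`.
  have hy' := closure_minimal (fun z hz => ?_) hC
    (denseRange_ofWord.open_subset_closure_inter ((isOpen_discrete F).preimage hΨ) hy)
  · obtain ⟨p, hp, hpy⟩ := hy'
    exact ⟨p, hpy.symm, hp⟩
  · obtain ⟨hz, w, rfl⟩ := hz
    have hw : w ∈ ψ ⁻¹' F := by simpa [hΨψ] using hz
    rw [← hL] at hw
    obtain ⟨_, ⟨w₀, hw₀, _, rfl, rfl⟩, w₁, hw₁, rfl⟩ := hw
    exact ⟨(ofWord w₀, ofWord w₁), ⟨hw₀, hw₁⟩, by simp [letter]⟩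

theorem exists_factorization_letter [Finite A]
    (hV : OrderedMonoidPseudovariety.PolynomiallyClosed.{u, w} V) (a : A) {x₀ x₁ y : Pseudoword A}
    (h : V.Satisfies (x₀ * letter a * x₁) y) :
    ∃ y₀ y₁ : Pseudoword A, y = y₀ * letter a * y₁ ∧ V.Satisfies x₀ y₀ ∧ V.Satisfies x₁ y₁ := by
  -- The empty product supplies a member of `V`.
  have : Nonempty (ContinuousMemHom V A) :=
    ⟨ContinuousMemHom.pi (Empty.elim : Empty → ContinuousMemHom V A)⟩
  obtain ⟨p, hp⟩ := IsCompact.nonempty_iInter_of_directed_nonempty_isCompact_isClosed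
    (fun Φ : ContinuousMemHom V A => factorizations Φ a x₀ x₁ y)
    -- An inequality under the product of `Φ` and `Φ'` holds under both.
    (fun Φ Φ' => ⟨ContinuousMemHom.pi fun b : Bool => cond b Φ Φ',
      fun _ hp => ⟨hp.1, hp.2.1 true, hp.2.2 true⟩,
      fun _ hp => ⟨hp.1, hp.2.1 false, hp.2.2 false⟩⟩)
    (fun Φ => factorizations_nonempty hV Φ a h)
    (fun Φ => (isClosed_factorizations Φ a x₀ x₁ y).isCompact)
    (fun Φ => isClosed_factorizations Φ a x₀ x₁ y)
  rw [Set.mem_iInter] at hp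
  exact ⟨p.1, p.2, (hp (Classical.arbitrary _)).1, satisfies_iff.2 fun Φ => (hp Φ).2.1,
    satisfies_iff.2 fun Φ => (hp Φ).2.2⟩

/-- If `x₀ = z a`, split `y` at the marker `a` and return the letter to the left factor. -/
theorem exists_factorization_mul [Finite A]
    (hV : OrderedMonoidPseudovariety.PolynomiallyClosed.{u, w} V) {x₀ x₁ y : Pseudoword A}
    (h : V.Satisfies (x₀ * x₁) y) :
    ∃ y₀ y₁ : Pseudoword A, y = y₀ * y₁ ∧ V.Satisfies x₀ y₀ ∧ V.Satisfies x₁ y₁ := by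
  rcases eq_one_or_eq_mul_letter x₀ with rfl | ⟨a, z, rfl⟩
  · exact ⟨1, y, (one_mul y).symm, .refl 1, by simpa using h⟩
  · obtain ⟨y₀, y₁, hy, h₀, h₁⟩ := exists_factorization_letter hV a h
    exact ⟨y₀ * letter a, y₁, hy, h₀.mul (.refl _), h₁⟩

theorem exists_factorization_ofFn [Finite A]
    (hV : OrderedMonoidPseudovariety.PolynomiallyClosed.{u, w} V) (n : ℕ)
    (xs : Fin (n + 1) → Pseudoword A) {y : Pseudoword A}
    (h : V.Satisfies (List.ofFn xs).prod y) :
    ∃ ys : Fin (n + 1) → Pseudoword A, y = (List.ofFn ys).prod ∧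
      ∀ i, V.Satisfies (xs i) (ys i) := by
  induction n generalizing y with
  | zero =>
    refine ⟨fun _ => y, by simp, fun i => ?_⟩
    rw [Fin.fin_one_eq_zero i]
    simpa using h
  | succ n ih =>
    rw [List.ofFn_succ, List.prod_cons] at h
    obtain ⟨y₀, y₁, rfl, h₀, h₁⟩ := exists_factorization_mul hV h
    obtain ⟨ys, rfl, hys⟩ := ih _ h₁
    refine ⟨Fin.cons y₀ ys, by simp [List.ofFn_succ], fun i => ?_⟩
    induction i using Fin.cases with
    | zero => exact h₀
    | succ i => exact hys i

end OrderedMonoidPseudovariety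

theorem mainTheorem6 (V : OrderedMonoidPseudovariety.{u})
    (hV : OrderedMonoidPseudovariety.PolynomiallyClosed.{u, w} V)
    {A : Type w} [Finite A] (x y : Pseudoword A) (hxy : V.Satisfies x y) :
    (∀ (a : A) (x₀ x₁ : Pseudoword A), x = x₀ * Pseudoword.letter a * x₁ →
      ∃ y₀ y₁ : Pseudoword A, y = y₀ * Pseudoword.letter a * y₁ ∧
        V.Satisfies x₀ y₀ ∧ V.Satisfies x₁ y₁) ∧
    (∀ (n : ℕ), 1 ≤ n → ∀ xs : Fin n → Pseudoword A, x = (List.ofFn xs).prod →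
      ∃ ys : Fin n → Pseudoword A, y = (List.ofFn ys).prod ∧
        ∀ i, V.Satisfies (xs i) (ys i)) := by
  refine ⟨?_, ?_⟩
  · rintro a x₀ x₁ rfl
    exact OrderedMonoidPseudovariety.exists_factorization_letter hV a hxy
  · rintro (_ | n) hn xs rfl
    · omega
    · exact OrderedMonoidPseudovariety.exists_factorization_ofFn hV n xs hxy
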